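/- Let $n$ be a positive integer, let $D$ be a set of positive divisors of $n$ that are smaller than $n$, and let $\mathrm{ICG}_n(D)$ be the integral circulant graph with vertex set $\mathbb{Z}_n=\{0,1,\dots,n-1\}$ in which $a$ and $b$ are adjacent if and only if $\gcd(a-b,n)\in D$. Let $A$ be its adjacency matrix, $\omega_n=e^{2\pi i/n}$ and $S=\{s\in\mathbb{Z}_n : \gcd(s,n)\in D\}$, and list the eigenvalues of $A$ (with multiplicity) as $$\lambda_j=\sum_{s\in S}\omega_n^{js},\qquad 0\le j\le n-1,$$ where $\lambda_j$ belongs to the eigenvector $v_j=(1,\omega_n^{j},\omega_n^{2j},\dots,\omega_n^{(n-1)j})$. Suppose that $\mathrm{ICG}_n(D)$ has perfect state transfer, that is, there are distinct vertices $a,b$ and a real number $t>0$ such that $|\exp(iAt)_{ab}|=1$. If $n/2\in D$, then all eigenvalues of $A$ are odd integers, and $\lambda_j=-1$ for every odd $j$ with $0\le j\le n-1$. If $n/2\notin D$, then all eigenvalues of $A$ are even integers, and $\lambda_j=0$ for every odd $j$ with $0\le j\le n-1$. -/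

import Mathlib

/-- The symbol `⋃_{d ∈ D} {k : gcd(k, n) = d}` of the integral circulant graph `ICG_n(D)`,
as a set of residues modulo `n`. -/
def icgSymbol (n : ℕ) [NeZero n] (D : Finset ℕ) : Finset (ZMod n) :=
  Finset.univ.filter (fun s => Nat.gcd s.val n ∈ D)

/-- The integral circulant graph `ICG_n(D)` on the vertex set `ℤ/nℤ`. -/
def ICG (n : ℕ) [NeZero n] (D : Finset ℕ) : SimpleGraph (ZMod n) :=
  SimpleGraph.circulantGraph (icgSymbol n D : Set (ZMod n))

instance instDecidableRelICGAdj (n : ℕ) [NeZero n] (D : Finset ℕ) :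
    DecidableRel (ICG n D).Adj :=
  inferInstanceAs (DecidableRel
    (SimpleGraph.circulantGraph (icgSymbol n D : Set (ZMod n))).Adj)

/-- The time evolution operator `F(t) = exp(i A t)` of a graph with adjacency matrix `A`. -/
noncomputable def evolution {V : Type*} [Fintype V] [DecidableEq V] (G : SimpleGraph V)
    [DecidableRel G.Adj] (t : ℝ) : Matrix V V ℂ :=
  NormedSpace.exp ((Complex.I * (t : ℂ)) • G.adjMatrix ℂ)

/-- Perfect state transfer: `|F(t)_{ab}| = 1` for some distinct vertices `a`, `b`
and some positive real time `t`. -/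
def HasPST {V : Type*} [Fintype V] [DecidableEq V] (G : SimpleGraph V)
    [DecidableRel G.Adj] : Prop :=
  ∃ a b : V, a ≠ b ∧ ∃ t : ℝ, 0 < t ∧ ‖evolution G t a b‖ = 1

/-- The primitive `n`-th root of unity `ω_n = exp(2πi / n)`. -/
noncomputable def icgRoot (n : ℕ) : ℂ :=
  Complex.exp (2 * (Real.pi : ℂ) * Complex.I / (n : ℂ))

/-- The `j`-th eigenvalue `λ_j = ∑_{s ∈ S} ω_n^{js}` of `ICG_n(D)`, where `S` is its symbol. -/
noncomputable def icgEigenvalue (n : ℕ) [NeZero n] (D : Finset ℕ) (j : ℕ) : ℂ :=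
  ∑ s ∈ icgSymbol n D, icgRoot n ^ (j * s.val)

/-- The `j`-th eigenvector `v_j = (1, ω_n^j, ω_n^{2j}, …, ω_n^{(n-1)j})`. -/
noncomputable def icgEigenvector (n : ℕ) (j : ℕ) : ZMod n → ℂ :=
  fun a => icgRoot n ^ (j * a.val)

theorem gcd_neg_val (n : ℕ) [NeZero n] (x : ZMod n) :
    Nat.gcd (-x).val n = Nat.gcd x.val n := by
  rw [ZMod.neg_val]
  split_ifs with h
  · simp [h]
  · exact Nat.gcd_self_sub_left (ZMod.val_lt x).le

/-- `a` and `b` are adjacent in `ICG_n(D)` iff `gcd(a - b, n) ∈ D`. -/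
theorem ICG_adj (n : ℕ) [NeZero n] (D : Finset ℕ) (hD : D ⊆ n.properDivisors)
    (a b : ZMod n) : (ICG n D).Adj a b ↔ Nat.gcd (a - b).val n ∈ D := by
  have h1 : Nat.gcd (b - a).val n = Nat.gcd (a - b).val n := by
    rw [← neg_sub a b, gcd_neg_val]
  simp only [ICG, SimpleGraph.circulantGraph, SimpleGraph.fromRel_adj, icgSymbol,
    Finset.coe_filter, Finset.mem_univ, true_and, Set.mem_setOf_eq, h1, or_self]
  refine ⟨fun h => h.2, fun h => ⟨?_, h⟩⟩
  rintro rfl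
  have := Nat.mem_properDivisors.1 (hD h)
  simp at this

theorem icgRoot_pow (n : ℕ) [NeZero n] : icgRoot n ^ n = 1 := by
  have hn : (n : ℂ) ≠ 0 := Nat.cast_ne_zero.2 (NeZero.ne n)
  rw [icgRoot, ← Complex.exp_nat_mul, mul_div_cancel₀ _ hn, Complex.exp_two_pi_mul_I]

theorem icgEigenvector_add (n : ℕ) [NeZero n] (j : ℕ) (a s : ZMod n) :
    icgEigenvector n j (a + s) = icgEigenvector n j a * icgEigenvector n j s := by
  have h : ∀ m : ℕ, (icgRoot n ^ j) ^ (m % n) = (icgRoot n ^ j) ^ m := by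
    intro m
    have h1 : (icgRoot n ^ j) ^ n = 1 := by
      rw [← pow_mul, mul_comm, pow_mul, icgRoot_pow, one_pow]
    exact (pow_eq_pow_mod m h1).symm
  simp only [icgEigenvector, pow_mul, ZMod.val_add, h, pow_add]

/-- `λ_j` is the eigenvalue of the adjacency matrix that belongs to the vector `v_j`. -/
theorem icg_mulVec_eigenvector (n : ℕ) [NeZero n] (D : Finset ℕ)
    (hD : D ⊆ n.properDivisors) (j : ℕ) :
    ((ICG n D).adjMatrix ℂ).mulVec (icgEigenvector n j)
      = icgEigenvalue n D j • icgEigenvector n j := by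
  funext a
  have h1 : ∀ s : ZMod n, (ICG n D).Adj a (a + s) ↔ s ∈ icgSymbol n D := by
    intro s
    rw [ICG_adj n D hD, sub_add_cancel_left, gcd_neg_val]
    simp [icgSymbol]
  have h2 : ((ICG n D).adjMatrix ℂ).mulVec (icgEigenvector n j) a
      = ∑ b : ZMod n, if (ICG n D).Adj a b then icgEigenvector n j b else 0 := by
    simp [Matrix.mulVec, dotProduct, SimpleGraph.adjMatrix_apply]
  rw [h2, ← Equiv.sum_comp (Equiv.addLeft a)]
  simp only [Equiv.coe_addLeft, h1, icgEigenvector_add]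
  rw [Finset.sum_ite_mem, Finset.univ_inter, ← Finset.mul_sum, Pi.smul_apply, smul_eq_mul,
    mul_comm]
  rfl

/-! Let `F` be the indicator of `D` and `G` its Möbius inverse. Summing roots of unity gives `λ_j =
∑_{m ∣ gcd(j, n)} m G(n / m)`, an integer.

The matrix `exp(iAt)` is unitary, so transfer from `a` to `b` leaves row `a` with one nonzero entry.
Applied to the `v_j`, this gives `exp(it(λ_j - λ_0)) = z ^ j` with `z = ω_n ^ (b - a) ≠ 1`. As
`λ_{n-1} = λ_1`, `z = -1`; hence `n` is even and all `λ_j` with `j` odd are congruent modulo `2`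
(`HasPST.even_and_congr`).

Write `n = 2 ^ (k + 1) * v` with `v` odd. Evaluating at odd divisors of `n` shows that `G (n / m)`
is even for odd `m ≠ 1`. Moreover `∑_{d ∣ u} G (2 ^ (k + 1) * d)` is a difference of two values of
`F`, hence lies in `{-1, 0, 1}`; induction on `u` turns "even" into "zero". The case `u = v` leaves
`G n = -F (n / 2)`. So an odd `j` sees only the term `m = 1`, while for other `j` the remaining
terms have even `m` (`divisorTransform_of_congr`). -/

/-! ### Divisor sums and parity -/

theorem exists_sum_divisors_eq (F : ℕ → ℤ) :
    ∃ G : ℕ → ℤ, ∀ m > 0, ∑ d ∈ m.divisors, G d = F m :=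
  ⟨fun m => ∑ x ∈ m.divisorsAntidiagonal, (ArithmeticFunction.moebius x.fst : ℤ) * F x.snd,
    ArithmeticFunction.sum_eq_iff_sum_mul_moebius_eq.2 fun _ _ => rfl⟩

/-- Divisors of `2 ^ (k + 1) * u` that do not divide `2 ^ k * u` are the `2 ^ (k + 1) * d`
with `d ∣ u`. -/
theorem sum_divisors_two_pow_mul (G : ℕ → ℤ) (k : ℕ) {u : ℕ} (hu : Odd u) :
    ∑ d ∈ (2 ^ (k + 1) * u).divisors, G d =
      ∑ d ∈ (2 ^ k * u).divisors, G d + ∑ d ∈ u.divisors, G (2 ^ (k + 1) * d) := by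
  have hc : ∀ k, Nat.Coprime (2 ^ k) u := fun k =>
    Nat.Coprime.pow_left k (Nat.coprime_two_left.2 hu)
  have h : ∀ k, ∑ d ∈ (2 ^ k * u).divisors, G d =
      ∑ i ∈ Finset.range (k + 1), ∑ d ∈ u.divisors, G (2 ^ i * d) := by
    intro k
    rw [Nat.divisors_mul, Finset.mul_def, Finset.sum_image (hc k).mul_injOn_divisors,
      Finset.sum_product, Nat.sum_divisors_prime_pow Nat.prime_two]
  rw [h, h, Finset.sum_range_succ]

/-- The integer `∑_{m ∣ gcd(j, n)} m G(n / m)`. -/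
def divisorTransform (G : ℕ → ℤ) (n j : ℕ) : ℤ :=
  ∑ m ∈ n.divisors with m ∣ j, (m : ℤ) * G (n / m)

/-- Only `m = 1` divides both `n` and `n - 1`. This gives `λ_{n-1} = λ_1`. -/
theorem divisorTransform_pred (G : ℕ → ℤ) {n : ℕ} (hn : 0 < n) :
    divisorTransform G n (n - 1) = divisorTransform G n 1 := by
  unfold divisorTransform
  congr 1
  refine Finset.filter_congr fun m hm => ?_
  have h1 : n - (n - 1) = 1 := by omega
  have h := Nat.dvd_of_mem_divisors hm
  constructor
  · intro h'
    exact h1 ▸ Nat.dvd_sub h h'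
  · intro h'
    rw [Nat.dvd_one.1 h']
    exact one_dvd _

/-- If the transforms at odd arguments agree modulo `2`, then `G (n / m)` is even for each odd
divisor `m ≠ 1` of `n`. -/
theorem even_of_divisorTransform_congr {G : ℕ → ℤ} {n : ℕ} (hn : n ≠ 0)
    (h : ∀ j, Odd j → Even (divisorTransform G n j - divisorTransform G n 1))
    (m : ℕ) (hm : Odd m) (hmn : m ∣ n) (hm1 : m ≠ 1) : Even (G (n / m)) := by
  induction m using Nat.strong_induction_on with
  | _ m ih =>
  have hm0 : m ≠ 0 := fun h0 => by simp [h0] at hm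
  have e : ∀ m, m ∣ n → divisorTransform G n m = ∑ d ∈ m.divisors, (d : ℤ) * G (n / d) := by
    intro m hmn
    unfold divisorTransform
    congr 1
    ext d
    simp only [Finset.mem_filter, Nat.mem_divisors]
    constructor
    · exact fun h => ⟨h.2, fun h0 => hn (Nat.eq_zero_of_zero_dvd (h0 ▸ hmn))⟩
    · exact fun h => ⟨⟨h.1.trans hmn, hn⟩, h.1⟩
  have h1 := h m hm
  -- The term `d = 1` is `G n`, which is the whole transform at `1` and cancels; the term `d = m` is
  -- the one sought.
  rw [e m hmn, e 1 (one_dvd _), ← Finset.sum_erase_add _ _ (Nat.mem_divisors_self m hm0),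
    ← Finset.sum_erase_add (m.divisors.erase m) _ (a := 1) (by
      simp [Ne.symm hm1, hm0])] at h1
  have h2 : Even (∑ d ∈ (m.divisors.erase m).erase 1, (d : ℤ) * G (n / d)) := by
    refine Finset.even_sum _ fun d hd => ?_
    simp only [Finset.mem_erase, Nat.mem_divisors] at hd
    obtain ⟨hd1, hdm, hd, -⟩ := hd
    exact (ih d (lt_of_le_of_ne (Nat.le_of_dvd (Nat.pos_of_ne_zero hm0) hd) hdm)
      (hm.of_dvd_nat hd) (hd.trans hmn) hd1).mul_left _
  simp only [Nat.divisors_one, Finset.sum_singleton] at h1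
  have h3 : Even ((m : ℤ) * G (n / m)) := by
    have := h1.sub h2
    ring_nf at this ⊢
    exact this
  exact (Int.even_mul.1 h3).resolve_left (by
    rw [Int.not_even_iff_odd]; exact_mod_cast hm)

/-- If the Möbius inverse of an indicator is even at `2 ^ (k + 1) * u` for all proper divisors
`u` of the odd number `v`, then it vanishes there. -/
theorem moebius_inverse_eq_zero {F G : ℕ → ℤ} {k v : ℕ} (hv : Odd v)
    (hG : ∀ m > 0, ∑ d ∈ m.divisors, G d = F m) (hF : ∀ m, F m = 0 ∨ F m = 1)
    (h : ∀ u, u ∣ v → u ≠ v → Even (G (2 ^ (k + 1) * u))) (u : ℕ) (huv : u ∣ v) (hu : u ≠ v) :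
    G (2 ^ (k + 1) * u) = 0 := by
  induction u using Nat.strong_induction_on with
  | _ u ih =>
  have hou := hv.of_dvd_nat huv
  have hu0 : 0 < u := hou.pos
  have h1 := sum_divisors_two_pow_mul G k hou
  rw [hG _ (by positivity), hG _ (by positivity)] at h1
  rw [Finset.sum_eq_single_of_mem u (Nat.mem_divisors_self u hu0.ne')] at h1
  · obtain ⟨c, hc⟩ := h u huv hu
    -- A difference of two values in `{0, 1}` that is even must be `0`.
    rcases hF (2 ^ (k + 1) * u) with h2 | h2 <;> rcases hF (2 ^ k * u) with h3 | h3 <;> omega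
  · intro d hd hdu
    have hd := Nat.dvd_of_mem_divisors hd
    have hlt := lt_of_le_of_ne (Nat.le_of_dvd hu0 hd) hdu
    exact ih d hlt (hd.trans huv) (hlt.trans_le (Nat.le_of_dvd hv.pos huv)).ne

/-- If the transforms of the Möbius inverse of an indicator `F` agree modulo `2` at all odd
arguments, then they equal `-F N` there, and all transforms have the parity of `F N`. -/
theorem divisorTransform_of_congr {F G : ℕ → ℤ} {N : ℕ} (hN : N ≠ 0)
    (hG : ∀ m > 0, ∑ d ∈ m.divisors, G d = F m) (hF : ∀ m, F m = 0 ∨ F m = 1)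
    (hFn : F (2 * N) = 0)
    (h : ∀ j, Odd j → Even (divisorTransform G (2 * N) j - divisorTransform G (2 * N) 1)) :
    (∀ j, Odd j → divisorTransform G (2 * N) j = -F N) ∧
      ∀ j, Even (divisorTransform G (2 * N) j - F N) := by
  obtain ⟨k, v, hv, rfl⟩ := Nat.exists_eq_two_pow_mul_odd hN
  have hv0 := hv.pos
  have hn : 2 * (2 ^ k * v) = 2 ^ (k + 1) * v := by ring
  rw [hn] at hFn h ⊢
  have hn0 : 2 ^ (k + 1) * v ≠ 0 := by positivity
  have hz : ∀ u, u ∣ v → u ≠ v → G (2 ^ (k + 1) * u) = 0 := by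
    refine moebius_inverse_eq_zero hv hG hF fun u huv hu => ?_
    obtain ⟨m, rfl⟩ := huv
    have hm : Odd m := hv.of_dvd_nat (dvd_mul_left m u)
    have := even_of_divisorTransform_congr hn0 h m hm ⟨2 ^ (k + 1) * u, by ring⟩
      (fun h1 => hu (by rw [h1, mul_one]))
    rwa [← mul_assoc, Nat.mul_div_cancel _ hm.pos] at this
  have hGn : G (2 ^ (k + 1) * v) = -F (2 ^ k * v) := by
    have h1 := sum_divisors_two_pow_mul G k hv
    rw [hG _ (by positivity), hG _ (by positivity), hFn,
      Finset.sum_eq_single_of_mem v (Nat.mem_divisors_self v hv0.ne')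
        fun d hd hdv => hz d (Nat.dvd_of_mem_divisors hd) hdv] at h1
    linarith
  have hodd : ∀ m, m ∣ 2 ^ (k + 1) * v → Odd m → m ≠ 1 → G (2 ^ (k + 1) * v / m) = 0 := by
    intro m hm ho hm1
    have hmv : m ∣ v := (Nat.Coprime.pow_right _ (Nat.coprime_two_right.2 ho)).dvd_of_dvd_mul_left hm
    rw [Nat.mul_div_assoc _ hmv]
    refine hz _ (Nat.div_dvd_of_dvd hmv) fun h' => hm1 ?_
    obtain ⟨c, rfl⟩ := hmv
    rw [Nat.mul_div_cancel_left _ ho.pos] at h'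
    exact Nat.eq_of_mul_eq_mul_right (Nat.pos_of_mul_pos_left hv0) (by linarith)
  have hsplit : ∀ j, divisorTransform G (2 ^ (k + 1) * v) j =
      (∑ m ∈ ((2 ^ (k + 1) * v).divisors.filter (· ∣ j)).erase 1,
        (m : ℤ) * G (2 ^ (k + 1) * v / m)) - F (2 ^ k * v) := by
    intro j
    rw [divisorTransform, ← Finset.sum_erase_add _ _ (a := 1) (by simp [hn0]), Nat.div_one, hGn]
    push_cast
    ring
  constructor
  · intro j hj
    rw [hsplit, Finset.sum_eq_zero, zero_sub]
    intro m hm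
    simp only [Finset.mem_erase, Finset.mem_filter, Nat.mem_divisors] at hm
    rw [hodd m hm.2.1.1 (hj.of_dvd_nat hm.2.2) hm.1, mul_zero]
  · intro j
    -- The two copies of `-F N` add up to an even number, so only the terms with `m ≠ 1` matter.
    rw [hsplit, sub_sub, ← two_mul]
    refine (Finset.even_sum _ fun m hm => ?_).sub (even_two_mul _)
    simp only [Finset.mem_erase, Finset.mem_filter, Nat.mem_divisors] at hm
    rcases Nat.even_or_odd m with he | ho
    · exact Even.mul_right (by exact_mod_cast he) _
    · simp [hodd m hm.2.1.1 ho hm.1]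

/-! ### Eigenvalues as divisor sums -/

theorem icgRoot_isPrimitiveRoot (n : ℕ) [NeZero n] : IsPrimitiveRoot (icgRoot n) n :=
  Complex.isPrimitiveRoot_exp n (NeZero.ne n)

theorem sum_univ_zmod_val {M : Type*} [AddCommMonoid M] (n : ℕ) [NeZero n] (f : ℕ → M) :
    ∑ s : ZMod n, f s.val = ∑ s ∈ Finset.range n, f s := by
  refine Finset.sum_bij (fun s _ => s.val) (fun s _ => Finset.mem_range.2 (ZMod.val_lt s))
    (fun s _ t _ h => ZMod.val_injective n h)
    (fun b hb => ⟨(b : ZMod n), Finset.mem_univ _,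
      ZMod.val_cast_of_lt (Finset.mem_range.1 hb)⟩) (fun _ _ => rfl)

theorem sum_range_mul_filter_dvd {M : Type*} [AddCommMonoid M] {d : ℕ} (hd : 0 < d) (m : ℕ)
    (f : ℕ → M) :
    ∑ s ∈ Finset.range (d * m) with d ∣ s, f s = ∑ i ∈ Finset.range m, f (d * i) := by
  symm
  refine Finset.sum_bij (fun i _ => d * i) ?_ ?_ ?_ (fun _ _ => rfl)
  · intro i hi
    simp only [Finset.mem_filter, Finset.mem_range] at hi ⊢
    exact ⟨Nat.mul_lt_mul_of_pos_left hi hd, dvd_mul_right _ _⟩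
  · intro a _ b _ h
    exact Nat.eq_of_mul_eq_mul_left hd h
  · intro b hb
    simp only [Finset.mem_filter, Finset.mem_range] at hb
    obtain ⟨hb, i, rfl⟩ := hb
    exact ⟨i, Finset.mem_range.2 (Nat.lt_of_mul_lt_mul_left hb), rfl⟩

/-- The multiples of `d` give a full geometric sum of the `m`-th root of unity `ω_n ^ (j * d)`,
which is `1` exactly when `m ∣ j`. -/
theorem sum_range_icgRoot_pow {n : ℕ} [NeZero n] {d m : ℕ} (hn : n = d * m) (j : ℕ) :
    ∑ s ∈ Finset.range n with d ∣ s, icgRoot n ^ (j * s) = if m ∣ j then (m : ℂ) else 0 := by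
  have hd : 0 < d := Nat.pos_of_ne_zero fun h => NeZero.ne n (by simp [hn, h])
  have hω := icgRoot_isPrimitiveRoot n
  have h0 : ∑ s ∈ Finset.range n with d ∣ s, icgRoot n ^ (j * s) =
      ∑ i ∈ Finset.range m, (icgRoot n ^ (j * d)) ^ i := by
    have := sum_range_mul_filter_dvd hd m (fun s => icgRoot n ^ (j * s))
    rw [← hn] at this
    rw [this]
    exact Finset.sum_congr rfl fun i _ => by rw [← pow_mul, mul_assoc]
  have h1 : icgRoot n ^ (j * d) = 1 ↔ m ∣ j := by
    rw [hω.pow_eq_one_iff_dvd]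
    conv_lhs => rw [hn, mul_comm j d]
    exact Nat.mul_dvd_mul_iff_left hd
  rw [h0]
  split_ifs with h
  · simp [h1.2 h]
  · have h2 : icgRoot n ^ (j * d) ≠ 1 := fun h' => h (h1.1 h')
    rw [geom_sum_eq h2, ← pow_mul, mul_assoc, ← hn, mul_comm, pow_mul, icgRoot_pow]
    simp

/-- The eigenvalues of `ICG_n(D)` are integers, given by a divisor sum. -/
theorem icgEigenvalue_eq_divisorTransform (n : ℕ) [NeZero n] (D : Finset ℕ) {G : ℕ → ℤ}
    (hG : ∀ m > 0, ∑ d ∈ m.divisors, G d = if m ∈ D then 1 else 0) (j : ℕ) :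
    icgEigenvalue n D j = (divisorTransform G n j : ℂ) := by
  have hn := Nat.pos_of_ne_zero (NeZero.ne n)
  have h1 : icgEigenvalue n D j =
      ∑ s ∈ Finset.range n, (if Nat.gcd s n ∈ D then icgRoot n ^ (j * s) else 0) := by
    rw [← sum_univ_zmod_val n (fun s => if Nat.gcd s n ∈ D then icgRoot n ^ (j * s) else 0),
      icgEigenvalue, icgSymbol, Finset.sum_filter]
  have h2 : ∀ s, (if Nat.gcd s n ∈ D then icgRoot n ^ (j * s) else 0) =
      ∑ d ∈ n.divisors, if d ∣ s then (G d : ℂ) * icgRoot n ^ (j * s) else 0 := by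
    intro s
    have h3 := congrArg (Int.cast : ℤ → ℂ) (hG _ (Nat.gcd_pos_of_pos_right s hn))
    push_cast at h3
    rw [← Finset.sum_filter, ← Finset.sum_mul]
    have h4 : n.divisors.filter (· ∣ s) = (Nat.gcd s n).divisors := by
      ext d
      simp only [Finset.mem_filter, Nat.mem_divisors, Nat.dvd_gcd_iff]
      exact ⟨fun h => ⟨⟨h.2, h.1.1⟩, (Nat.gcd_pos_of_pos_right s hn).ne'⟩,
        fun h => ⟨⟨h.1.2, hn.ne'⟩, h.1.1⟩⟩
    rw [h4, h3, ite_mul, one_mul, zero_mul]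
  -- After exchanging the sums, the outer one is reindexed by `d = n / m`.
  rw [h1, Finset.sum_congr rfl fun s _ => h2 s, Finset.sum_comm, divisorTransform,
    ← Nat.sum_div_divisors, Finset.sum_filter]
  push_cast
  refine Finset.sum_congr rfl fun m hm => ?_
  have hmn : n = n / m * m := (Nat.div_mul_cancel (Nat.dvd_of_mem_divisors hm)).symm
  rw [← Finset.sum_filter, ← Finset.mul_sum, sum_range_icgRoot_pow hmn]
  split_ifs <;> simp [mul_comm]

/-! ### Perfect state transfer and phases -/

theorem exp_mulVec_of_mulVec_eq_smul {V : Type*} [Fintype V] [DecidableEq V]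
    {M : Matrix V V ℂ} {x : ℂ} {v : V → ℂ} (h : M.mulVec v = x • v) :
    (NormedSpace.exp M).mulVec v = Complex.exp x • v := by
  have hpow : ∀ k : ℕ, (M ^ k).mulVec v = x ^ k • v := by
    intro k
    induction k with
    | zero => simp
    | succ k ih => rw [pow_succ, ← Matrix.mulVec_mulVec, h, Matrix.mulVec_smul, ih, smul_smul,
        pow_succ, mul_comm]
  have h1 : HasSum (fun k : ℕ => ((k.factorial : ℂ)⁻¹) • M ^ k) (NormedSpace.exp M) := by
    open scoped Matrix.Norms.Operator in
    exact NormedSpace.exp_series_hasSum_exp' (𝕂 := ℂ) M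
  let φ : Matrix V V ℂ →+ (V → ℂ) :=
    { toFun := fun M => M.mulVec v
      map_zero' := Matrix.zero_mulVec v
      map_add' := fun A B => Matrix.add_mulVec A B v }
  have hφ : Continuous φ := by
    change Continuous fun M : Matrix V V ℂ => M.mulVec v
    fun_prop
  have h2 := h1.map φ hφ
  have h3 : HasSum (fun k : ℕ => ((k.factorial : ℂ)⁻¹ • x ^ k) • v) (Complex.exp x • v) := by
    rw [Complex.exp_eq_exp_ℂ]
    exact (NormedSpace.exp_series_hasSum_exp' (𝕂 := ℂ) x).smul_const v
  refine h2.unique ?_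
  convert h3 using 2 with k
  change (((k.factorial : ℂ)⁻¹) • M ^ k).mulVec v = _
  rw [Matrix.smul_mulVec, hpow, smul_smul, smul_eq_mul]

/-- Since `A` is real symmetric, `iAt` is skew-Hermitian, so its exponential is unitary. -/
theorem evolution_mul_conjTranspose {V : Type*} [Fintype V] [DecidableEq V] (G : SimpleGraph V)
    [DecidableRel G.Adj] (t : ℝ) : evolution G t * (evolution G t).conjTranspose = 1 := by
  have h : ((Complex.I * (t : ℂ)) • G.adjMatrix ℂ).conjTranspose =
      -((Complex.I * (t : ℂ)) • G.adjMatrix ℂ) := by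
    ext a b
    simp [SimpleGraph.adjMatrix_apply, G.adj_comm]
    split_ifs <;> simp
  rw [evolution, ← Matrix.exp_conjTranspose, h, Matrix.exp_neg]
  exact Matrix.mul_nonsing_inv _ ((Matrix.isUnit_iff_isUnit_det _).1 (Matrix.isUnit_exp _))

/-- If one entry of a row of a unitary matrix is unimodular, the others in that row vanish. -/
theorem apply_eq_zero_of_norm_eq_one {V : Type*} [Fintype V] [DecidableEq V]
    {U : Matrix V V ℂ} (hU : U * U.conjTranspose = 1) {a b c : V} (hab : ‖U a b‖ = 1)
    (hcb : c ≠ b) : U a c = 0 := by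
  have h1 : ∑ d, ‖U a d‖ ^ 2 = (1 : ℝ) := by
    have h2 := congrFun (congrFun hU a) a
    rw [Matrix.mul_apply, Matrix.one_apply_eq] at h2
    simp only [Matrix.conjTranspose_apply, RCLike.star_def, Complex.mul_conj'] at h2
    exact_mod_cast h2
  rw [← Finset.add_sum_erase _ _ (Finset.mem_univ b), hab] at h1
  have h2 : ∑ d ∈ Finset.univ.erase b, ‖U a d‖ ^ 2 = (0 : ℝ) := by linarith
  have h3 := (Finset.sum_eq_zero_iff_of_nonneg fun d _ => by positivity).1 h2 c
    (Finset.mem_erase.2 ⟨hcb, Finset.mem_univ _⟩)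
  simpa using h3

/-- Perfect state transfer in `ICG_n(D)` forces `exp(i (λ_j - λ_0) t) = (ω_n ^ s) ^ j` for some
nonzero residue `s`. -/
theorem HasPST.exists_exp_eq {n : ℕ} [NeZero n] {D : Finset ℕ} (hD : D ⊆ n.properDivisors)
    (h : HasPST (ICG n D)) :
    ∃ (t : ℝ) (s : ZMod n), s ≠ 0 ∧ ∀ j : ℕ,
      Complex.exp (Complex.I * t * (icgEigenvalue n D j - icgEigenvalue n D 0)) =
        (icgRoot n ^ s.val) ^ j := by
  obtain ⟨a, b, hab, t, -, hU⟩ := h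
  refine ⟨t, b - a, sub_ne_zero.2 hab.symm, fun j => ?_⟩
  have hrow : ∀ j, evolution (ICG n D) t a b * icgEigenvector n j b =
      Complex.exp (Complex.I * t * icgEigenvalue n D j) * icgEigenvector n j a := by
    intro j
    have h1 : ((Complex.I * (t : ℂ)) • (ICG n D).adjMatrix ℂ).mulVec (icgEigenvector n j) =
        (Complex.I * t * icgEigenvalue n D j) • icgEigenvector n j := by
      rw [Matrix.smul_mulVec, icg_mulVec_eigenvector n D hD, smul_smul]
    have h2 := congrFun (exp_mulVec_of_mulVec_eq_smul h1) a
    rw [Matrix.mulVec, dotProduct, Finset.sum_eq_single b] at h2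
    · exact h2
    · intro c _ hc
      have := apply_eq_zero_of_norm_eq_one (evolution_mul_conjTranspose (ICG n D) t) hU hc
      rw [evolution] at this
      rw [this, zero_mul]
    · simp
  -- As `v_0` is constant `1`, the case `j = 0` identifies the entry at `(a, b)` with `exp(i t
  -- λ_0)`.
  have h0 := hrow 0
  simp only [icgEigenvector, zero_mul, pow_zero, mul_one] at h0
  have hj := hrow j
  have hb : icgEigenvector n j b = icgEigenvector n j a * icgEigenvector n j (b - a) := by
    rw [← icgEigenvector_add, add_sub_cancel]
  have ha : icgEigenvector n j a ≠ 0 := pow_ne_zero _ (Complex.exp_ne_zero _)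
  rw [hb, h0] at hj
  have h3 : Complex.exp (Complex.I * t * icgEigenvalue n D 0) * icgEigenvector n j (b - a) =
      Complex.exp (Complex.I * t * icgEigenvalue n D j) := by
    apply mul_right_cancel₀ ha
    linear_combination hj
  rw [mul_sub, Complex.exp_sub, ← h3, mul_div_cancel_left₀ _ (Complex.exp_ne_zero _),
    icgEigenvector, ← pow_mul, mul_comm]

/-- Both `t x` and `t y` are odd multiples of `π`; eliminating `t` gives `x (2d + 1) = y (2c + 1)`,
hence `x - y = 2 (y c - x d)`. -/
theorem even_sub_of_exp_eq_neg_one {t : ℝ} {x y : ℤ}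
    (hx : Complex.exp (Complex.I * t * x) = -1) (hy : Complex.exp (Complex.I * t * y) = -1) :
    Even (x - y) := by
  have key : ∀ {z : ℤ}, Complex.exp (Complex.I * t * z) = -1 →
      ∃ c : ℤ, t * z = (2 * c + 1) * Real.pi := by
    intro z hz
    rw [← Complex.exp_pi_mul_I, Complex.exp_eq_exp_iff_exists_int] at hz
    obtain ⟨c, hc⟩ := hz
    refine ⟨c, ?_⟩
    have h1 : Complex.I * (t * z : ℂ) = Complex.I * ((2 * c + 1) * Real.pi) := by
      linear_combination hc
    exact_mod_cast mul_left_cancel₀ Complex.I_ne_zero h1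
  obtain ⟨c, hc⟩ := key hx
  obtain ⟨d, hd⟩ := key hy
  have ht : t ≠ 0 := by
    rintro rfl
    norm_num at hx
  have h1 : (x : ℝ) * (2 * d + 1) = y * (2 * c + 1) := by
    apply mul_left_cancel₀ (mul_ne_zero ht Real.pi_ne_zero)
    linear_combination Real.pi * (2 * d + 1) * hc - Real.pi * (2 * c + 1) * hd
  have h2 : x * (2 * d + 1) = y * (2 * c + 1) := by exact_mod_cast h1
  exact ⟨y * c - x * d, by linear_combination h2⟩

/-! ### Completeness of the list of eigenvalues -/

/-- A vector that is orthogonal to every `v_j` vanishes. -/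
theorem eq_zero_of_dotProduct_icgEigenvector (n : ℕ) [NeZero n] {v : ZMod n → ℂ}
    (h : ∀ j < n, ∑ a, v a * icgEigenvector n j a = 0) : v = 0 := by
  -- `ZMod (k + 1)` is `Fin (k + 1)` by definition, so the Vandermonde criterion with the distinct
  -- nodes `ω_n ^ a` applies.
  obtain ⟨k, rfl⟩ : ∃ k, n = k + 1 := ⟨n - 1, (Nat.succ_pred (NeZero.ne n)).symm⟩
  refine Matrix.eq_zero_of_forall_pow_sum_mul_pow_eq_zero (n := k + 1)
    (f := fun a : ZMod (k + 1) => icgRoot (k + 1) ^ a.val) ?_ ?_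
  · intro a b hab
    exact ZMod.val_injective _
      ((icgRoot_isPrimitiveRoot (k + 1)).pow_inj (ZMod.val_lt a) (ZMod.val_lt b) hab)
  · have hpow : ∀ (a : ZMod (k + 1)) (i : ℕ), v a * (icgRoot (k + 1) ^ a.val) ^ i =
        v a * icgEigenvector (k + 1) i a := fun a i => by
      rw [icgEigenvector, ← pow_mul, mul_comm a.val]
    exact fun i => (Finset.sum_congr rfl fun a _ => hpow a i).trans (h i i.isLt)

/-- Every eigenvalue of the adjacency matrix of `ICG_n(D)` is one of the `λ_j`. -/
theorem exists_eq_icgEigenvalue {n : ℕ} [NeZero n] {D : Finset ℕ} (hD : D ⊆ n.properDivisors)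
    {x : ℂ} (hx : Module.End.HasEigenvalue (Matrix.toLin' ((ICG n D).adjMatrix ℂ)) x) :
    ∃ j < n, x = icgEigenvalue n D j := by
  obtain ⟨v, hv⟩ := hx.exists_hasEigenvector
  have hAv : ((ICG n D).adjMatrix ℂ).mulVec v = x • v := by
    simpa using hv.apply_eq_smul
  by_contra! hne
  refine hv.2 (eq_zero_of_dotProduct_icgEigenvector n fun j hj => ?_)
  -- Symmetry of `A` under the bilinear pairing gives `x (v ⬝ v_j) = λ_j (v ⬝ v_j)`.
  have h1 : dotProduct v (((ICG n D).adjMatrix ℂ).mulVec (icgEigenvector n j)) =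
      dotProduct (((ICG n D).adjMatrix ℂ).mulVec v) (icgEigenvector n j) := by
    rw [Matrix.dotProduct_mulVec, ← Matrix.mulVec_transpose, SimpleGraph.transpose_adjMatrix]
  rw [icg_mulVec_eigenvector n D hD, hAv, dotProduct_smul, smul_dotProduct, smul_eq_mul,
    smul_eq_mul] at h1
  have h2 : (x - icgEigenvalue n D j) * dotProduct v (icgEigenvector n j) = 0 := by
    linear_combination -h1
  exact (mul_eq_zero.1 h2).resolve_left (sub_ne_zero.2 (hne j hj))

/-- If `ICG_n(D)` has perfect state transfer, then `n` is even and the differences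
`λ_j - λ_0` for odd `j` have the same parity. -/
theorem HasPST.even_and_congr {n : ℕ} [NeZero n] {D : Finset ℕ} (hD : D ⊆ n.properDivisors)
    (h : HasPST (ICG n D)) {G : ℕ → ℤ}
    (hG : ∀ m > 0, ∑ d ∈ m.divisors, G d = if m ∈ D then 1 else 0) :
    Even n ∧ ∀ j, Odd j → Even (divisorTransform G n j - divisorTransform G n 1) := by
  have hn := Nat.pos_of_ne_zero (NeZero.ne n)
  obtain ⟨t, s, hs, hexp⟩ := h.exists_exp_eq hD
  simp only [icgEigenvalue_eq_divisorTransform n D hG] at hexp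
  set z := icgRoot n ^ s.val with hz
  have hzn : z ^ n = 1 := by rw [hz, ← pow_mul, mul_comm, pow_mul, icgRoot_pow, one_pow]
  have hz1 : z ≠ 1 := by
    intro h1
    rw [hz, (icgRoot_isPrimitiveRoot n).pow_eq_one_iff_dvd] at h1
    have := Nat.eq_zero_of_dvd_of_lt h1 (ZMod.val_lt s)
    exact hs ((ZMod.val_eq_zero s).1 this)
  -- From `λ_{n-1} = λ_1` follows `z ^ (n - 1) = z`, and `z ^ n = 1`.
  have hzz : z * z = 1 := by
    have h1 := hexp (n - 1)
    rw [divisorTransform_pred G hn, hexp 1, pow_one] at h1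
    nth_rw 1 [h1]
    rw [← pow_succ, Nat.sub_add_cancel hn, hzn]
  have hzneg : z = -1 := (mul_self_eq_one_iff.1 hzz).resolve_left hz1
  have hodd : ∀ j, Odd j →
      Complex.exp (Complex.I * t * ((divisorTransform G n j - divisorTransform G n 0 : ℤ) : ℂ))
        = -1 := by
    intro j hj
    rw [Int.cast_sub, hexp j, hzneg, hj.neg_one_pow]
  refine ⟨?_, fun j hj => ?_⟩
  · rw [hzneg] at hzn
    by_contra ho
    rw [Nat.not_even_iff_odd] at ho
    rw [ho.neg_one_pow] at hzn
    norm_num at hzn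
  · have := even_sub_of_exp_eq_neg_one (hodd j hj) (hodd 1 odd_one)
    rwa [sub_sub_sub_cancel_right] at this

theorem mainTheorem3 (n : ℕ) [NeZero n] (D : Finset ℕ) (hD : D ⊆ n.properDivisors)
    (hPST : HasPST (ICG n D)) :
    ((∃ d ∈ D, 2 * d = n) →
      (∀ x : ℂ, Module.End.HasEigenvalue (Matrix.toLin' ((ICG n D).adjMatrix ℂ)) x →
        ∃ k : ℤ, Odd k ∧ x = (k : ℂ)) ∧
      (∀ j : ℕ, j < n → Odd j → icgEigenvalue n D j = -1)) ∧
    ((¬ ∃ d ∈ D, 2 * d = n) →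
      (∀ x : ℂ, Module.End.HasEigenvalue (Matrix.toLin' ((ICG n D).adjMatrix ℂ)) x →
        ∃ k : ℤ, Even k ∧ x = (k : ℂ)) ∧
      (∀ j : ℕ, j < n → Odd j → icgEigenvalue n D j = 0)) := by
  obtain ⟨G, hG⟩ := exists_sum_divisors_eq fun m => if m ∈ D then 1 else 0
  obtain ⟨hn, hcongr⟩ := hPST.even_and_congr hD hG
  obtain ⟨N, rfl⟩ := hn.two_dvd
  have hN : N ≠ 0 := fun h0 => NeZero.ne (2 * N) (by rw [h0, mul_zero])
  obtain ⟨hval, hpar⟩ := divisorTransform_of_congr hN hG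
    (fun m => (ite_eq_or_eq (m ∈ D) (1 : ℤ) 0).symm)
    (if_neg fun h => lt_irrefl _ (Nat.mem_properDivisors.1 (hD h)).2) hcongr
  have hiff : (∃ d ∈ D, 2 * d = 2 * N) ↔ N ∈ D := by simp
  rw [hiff]
  refine ⟨fun hND => ⟨fun x hx => ?_, fun j _ hj => ?_⟩,
    fun hND => ⟨fun x hx => ?_, fun j _ hj => ?_⟩⟩
  · obtain ⟨j, -, rfl⟩ := exists_eq_icgEigenvalue hD hx
    refine ⟨_, ?_, icgEigenvalue_eq_divisorTransform _ D hG j⟩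
    have h1 := hpar j
    rw [if_pos hND] at h1
    simpa using h1.add_odd odd_one
  · rw [icgEigenvalue_eq_divisorTransform _ D hG, hval j hj, if_pos hND]
    simp
  · obtain ⟨j, -, rfl⟩ := exists_eq_icgEigenvalue hD hx
    refine ⟨_, ?_, icgEigenvalue_eq_divisorTransform _ D hG j⟩
    simpa [if_neg hND] using hpar j
  · rw [icgEigenvalue_eq_divisorTransform _ D hG, hval j hj, if_neg hND]
    simp
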